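/- Let $V$ be a real Banach space with dual $(V^\star,\|\cdot\|_\star)$, and suppose that $V$ is $(2,\lambda)$-uniformly convex for some $\lambda>0$, i.e. $\|x+y\|^2+\|x-y\|^2\ge 2\|x\|^2+2\lambda\|y\|^2$ for all $x,y\in V$. Let $(\hat g_t)_{t\ge1}$ be a $V^\star$-valued martingale difference sequence (strongly measurable and integrable) with respect to a filtration $(\mathcal F_t)_{t\ge0}$, i.e. $\hat g_t$ is $\mathcal F_t$-measurable and $\mathbb E[\hat g_t\mid\mathcal F_{t-1}]=0$ for all $t\ge 1$ (for instance with $\mathcal F_t=\sigma(\hat g_1,\dots,\hat g_t)$). Suppose that it is conditionally sub-Gaussian with parameter $\sigma_{1D}>0$: for all $t\ge1$, all $a\in V$ with $\|a\|\le1$ and all $\beta\in\mathbb R$, $$\mathbb E\big[\exp(\beta\langle \hat g_t,a\rangle)\mid\mathcal F_{t-1}\big]\le\exp\big(\beta^2\sigma_{1D}^2/2\big)\quad\text{almost surely.}$$ Then, for every $\delta\in(0,1)$, $$\mathbb P\left(\exists\, t\ge1:\ \Big\|\sum_{s=1}^t\hat g_s\Big\|_\star\ \ge\ \sqrt{\frac2\lambda\sum_{s=1}^t\|\hat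 g_s\|_\star^2}+\sigma_{1D}\sqrt{2t\ln\!\left(\Big(\frac{6\pi\sqrt e}{\delta}\Big)^{3/2}\big(\ln^2(\sqrt t)+1\big)\right)}\right)\le\delta .$$ -/

import Mathlib

open MeasureTheory

/-- `V` is `(2, lam)`-uniformly convex:
`‖x + y‖² + ‖x - y‖² ≥ 2 ‖x‖² + 2 lam ‖y‖²` for all `x, y`.
Hilbert spaces satisfy it with `lam = 1`, and `L^p` spaces with `lam = p - 1` for `1 < p ≤ 2`. -/
def IsTwoUniformlyConvex (V : Type*) [NormedAddCommGroup V] (lam : ℝ) : Prop :=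
  0 < lam ∧ ∀ x y : V, 2 * ‖x‖ ^ 2 + 2 * lam * ‖y‖ ^ 2 ≤ ‖x + y‖ ^ 2 + ‖x - y‖ ^ 2

/-- `g 1, g 2, …` is a martingale difference sequence for `ℱ` with values in the dual of `V`
(the value `g 0` plays no role). -/
structure IsDualMartingaleDifference {V : Type*} [NormedAddCommGroup V] [NormedSpace ℝ V]
    {Ω : Type*} {mΩ : MeasurableSpace Ω} (P : Measure Ω) (ℱ : Filtration ℕ mΩ)
    (g : ℕ → Ω → StrongDual ℝ V) : Prop where
  adapted : ∀ t : ℕ, StronglyMeasurable[ℱ (t + 1)] (g (t + 1))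
  integrable : ∀ t : ℕ, Integrable (g (t + 1)) P
  condExp_eq_zero : ∀ t : ℕ, P[g (t + 1) | ℱ t] =ᵐ[P] 0

/-- `g 1, g 2, …` is conditionally sub-Gaussian with parameter `σ ^ 2` in every direction `a` of the
unit ball of `V`: `E[exp (β ⟨g (t+1), a⟩) | ℱ t] ≤ exp (β² σ² / 2)` a.s. for every real `β`.
Integrability is required because `P[· | ℱ t]` is `0` by convention on non-integrable functions. -/
def IsCondSubgaussianDual {V : Type*} [NormedAddCommGroup V] [NormedSpace ℝ V]
    {Ω : Type*} {mΩ : MeasurableSpace Ω} (P : Measure Ω) (ℱ : Filtration ℕ mΩ)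
    (g : ℕ → Ω → StrongDual ℝ V) (σ : ℝ) : Prop :=
  ∀ (t : ℕ) (a : V), ‖a‖ ≤ 1 → ∀ β : ℝ,
    Integrable (fun ω => Real.exp (β * g (t + 1) ω a)) P ∧
    ∀ᵐ ω ∂P, (P[fun ω' => Real.exp (β * g (t + 1) ω' a) | ℱ t]) ω
      ≤ Real.exp (β ^ 2 * σ ^ 2 / 2)

/-! ### Regularized linear maximization on the unit ball and its regret bound. -/

section Regularized

variable {V : Type*} [NormedAddCommGroup V] [NormedSpace ℝ V] {lam R : ℝ}

/-! The dual norm of `S` is the supremum of `S x` over the unit ball, and no single direction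
attains it for all times. Penalizing by `R / 2 * ‖x‖ ^ 2` makes the maximizer unique and, by uniform
convexity, Lipschitz in `S`. Playing the maximizer for the past sum against the next increment is
follow-the-regularized-leader. Its regret bound `norm_sum_le_of_penalizedArgmax` is pathwise: the
norm of the sum is at most `R / 2 + Q / (2 * lam * R)`, with `Q` the quadratic variation, plus a
scalar sum `N` of increments evaluated in predictable unit-ball directions.

The exponential of `β * N`, suitably compensated, is a supermartingale, so Ville's inequality
controls `N` at all times at once (`IsCondSubgaussianDual.measure_exists_le`).

The best `R` is random, as is the time scale. Hence a union bound over epochs `4 ^ j ≤ t ≤ 4 ^ (j +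
1)` and levels `R = σ * 2 ^ j * 2 ^ k`. Tuning `R` exactly would cost `√(Q / lam)`; the boundary
allows `√2` times that, and this slack pays both for the dyadic grid and for the union over `k`
(`exists_level`). The sum over `j` telescopes (`exp_neg_epochExponent_le`). -/

/-- The value at `x` of the linear functional `S`, penalized by `R / 2 * ‖x‖ ^ 2`. -/
noncomputable def penalized (R : ℝ) (S : StrongDual ℝ V) (x : V) : ℝ := S x - R / 2 * ‖x‖ ^ 2

lemma IsTwoUniformlyConvex.penalized_midpoint (hV : IsTwoUniformlyConvex V lam) (hR : 0 < R)
    (S : StrongDual ℝ V) (x y : V) :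
    (penalized R S x + penalized R S y) / 2 + lam * R / 8 * ‖x - y‖ ^ 2
      ≤ penalized R S ((1 / 2 : ℝ) • (x + y)) := by
  have h := hV.2 ((1 / 2 : ℝ) • (x + y)) ((1 / 2 : ℝ) • (x - y))
  have e1 : (1 / 2 : ℝ) • (x + y) + (1 / 2 : ℝ) • (x - y) = x := by module
  have e2 : (1 / 2 : ℝ) • (x + y) - (1 / 2 : ℝ) • (x - y) = y := by module
  rw [e1, e2, norm_smul (1 / 2 : ℝ) (x - y)] at h
  have h3 : ‖(1 / 2 : ℝ)‖ = 1 / 2 := by norm_num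
  rw [h3] at h
  simp only [penalized, map_smul, map_add, smul_eq_mul]
  nlinarith [mul_le_mul_of_nonneg_left h hR.le]

lemma norm_half_smul_add_le {x y : V} (hx : ‖x‖ ≤ 1) (hy : ‖y‖ ≤ 1) :
    ‖(1 / 2 : ℝ) • (x + y)‖ ≤ 1 := by
  have h3 : ‖(1 / 2 : ℝ)‖ = 1 / 2 := by norm_num
  rw [norm_smul, h3]
  linarith [norm_add_le x y]

lemma continuous_penalized (R : ℝ) (S : StrongDual ℝ V) : Continuous (penalized R S) := by
  unfold penalized
  fun_prop

lemma IsTwoUniformlyConvex.exists_isMaxOn_penalized [CompleteSpace V]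
    (hV : IsTwoUniformlyConvex V lam) (hR : 0 < R) (S : StrongDual ℝ V) :
    ∃ a : V, ‖a‖ ≤ 1 ∧ ∀ x : V, ‖x‖ ≤ 1 → penalized R S x ≤ penalized R S a := by
  set A : Set ℝ := penalized R S '' {x | ‖x‖ ≤ 1} with hA
  have hne : A.Nonempty := ⟨_, 0, by simp, rfl⟩
  have hbdd : BddAbove A := by
    refine ⟨‖S‖, ?_⟩
    rintro _ ⟨x, hx, rfl⟩
    have h1 : S x ≤ ‖S‖ * ‖x‖ := (le_abs_self _).trans (S.le_opNorm x)
    have h2 : ‖S‖ * ‖x‖ ≤ ‖S‖ * 1 := mul_le_mul_of_nonneg_left hx (norm_nonneg _)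
    have h3 : 0 ≤ R / 2 * ‖x‖ ^ 2 := by positivity
    simp only [penalized]
    linarith
  have hle : ∀ x : V, ‖x‖ ≤ 1 → penalized R S x ≤ sSup A := fun x hx =>
    le_csSup hbdd ⟨x, hx, rfl⟩
  have hex : ∀ n : ℕ, ∃ x : V, ‖x‖ ≤ 1 ∧ sSup A - 1 / ((n : ℝ) + 1) < penalized R S x := by
    intro n
    have hpos : (0 : ℝ) < 1 / ((n : ℝ) + 1) := by positivity
    obtain ⟨_, ⟨x, hx, rfl⟩, h⟩ := exists_lt_of_lt_csSup hne (sub_lt_self (sSup A) hpos)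
    exact ⟨x, hx, h⟩
  choose x hx1 hx2 using hex
  have hc : 0 < lam * R / 8 := by have := hV.1; positivity
  have hcau : CauchySeq x := by
    refine cauchySeq_of_le_tendsto_0
      (fun N : ℕ => Real.sqrt (1 / (lam * R / 8) * (1 / ((N : ℝ) + 1)))) ?_ ?_
    · intro n m N hn hm
      -- Two near-maximizers must be close: otherwise their midpoint would exceed the supremum.
      have h := hV.penalized_midpoint hR S (x n) (x m)
      have hs := hle _ (norm_half_smul_add_le (hx1 n) (hx1 m))
      have hn' : 1 / ((n : ℝ) + 1) ≤ 1 / ((N : ℝ) + 1) := by gcongr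
      have hm' : 1 / ((m : ℝ) + 1) ≤ 1 / ((N : ℝ) + 1) := by gcongr
      have := hx2 n
      have := hx2 m
      rw [dist_eq_norm]
      apply Real.le_sqrt_of_sq_le
      rw [div_mul_eq_mul_div, one_mul, le_div_iff₀ hc]
      linarith
    · have h := (tendsto_one_div_add_atTop_nhds_zero_nat (𝕜 := ℝ)).const_mul (1 / (lam * R / 8))
      rw [mul_zero] at h
      simpa [Function.comp_def] using (Real.continuous_sqrt.tendsto 0).comp h
  obtain ⟨a, ha⟩ := cauchySeq_tendsto_of_complete hcau
  refine ⟨a, le_of_tendsto ha.norm (Filter.Eventually.of_forall hx1), fun y hy => ?_⟩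
  have h1 : Filter.Tendsto (fun n => penalized R S (x n)) Filter.atTop
      (nhds (penalized R S a)) := ((continuous_penalized R S).tendsto a).comp ha
  have h2 := (tendsto_one_div_add_atTop_nhds_zero_nat (𝕜 := ℝ)).const_sub (sSup A)
  rw [sub_zero] at h2
  exact (hle y hy).trans (le_of_tendsto_of_tendsto' h2 h1 fun n => (hx2 n).le)

/-- The midpoint inequality alone loses a factor 2 in the quadratic gap. Iterating it along halvings
towards `a` gives the constant `1 - (1 / 2) ^ n`, and the limit recovers the full gap. -/
lemma IsTwoUniformlyConvex.penalized_add_le (hV : IsTwoUniformlyConvex V lam) (hR : 0 < R)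
    {S : StrongDual ℝ V} {a : V} (ha : ‖a‖ ≤ 1)
    (hmax : ∀ x : V, ‖x‖ ≤ 1 → penalized R S x ≤ penalized R S a) {x : V} (hx : ‖x‖ ≤ 1) :
    penalized R S x + lam * R / 2 * ‖x - a‖ ^ 2 ≤ penalized R S a := by
  have key : ∀ n : ℕ, ∀ x : V, ‖x‖ ≤ 1 →
      penalized R S x + (1 - (1 / 2 : ℝ) ^ n) * (lam * R / 2) * ‖x - a‖ ^ 2
        ≤ penalized R S a := by
    intro n
    induction n with
    | zero => intro x hx; simpa using hmax x hx
    | succ n ih =>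
      intro x hx
      have h1 := ih _ (norm_half_smul_add_le hx ha)
      have h2 := hV.penalized_midpoint hR S x a
      have e : (1 / 2 : ℝ) • (x + a) - a = (1 / 2 : ℝ) • (x - a) := by module
      have h3 : ‖(1 / 2 : ℝ)‖ = 1 / 2 := by norm_num
      rw [e, norm_smul, h3] at h1
      rw [pow_succ]
      linarith
  have hl : Filter.Tendsto (fun n : ℕ => penalized R S x
      + (1 - (1 / 2 : ℝ) ^ n) * (lam * R / 2) * ‖x - a‖ ^ 2) Filter.atTop
      (nhds (penalized R S x + (1 - 0) * (lam * R / 2) * ‖x - a‖ ^ 2)) :=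
    (((tendsto_pow_atTop_nhds_zero_of_lt_one (by norm_num) (by norm_num)).const_sub 1
      |>.mul_const _).mul_const _).const_add _
  simpa using le_of_tendsto' hl fun n => key n x hx

variable [CompleteSpace V]

/-- The point of the unit ball at which `penalized R S` is largest. -/
noncomputable def penalizedArgmax (hV : IsTwoUniformlyConvex V lam) (hR : 0 < R)
    (S : StrongDual ℝ V) : V :=
  (hV.exists_isMaxOn_penalized hR S).choose

variable (hV : IsTwoUniformlyConvex V lam) (hR : 0 < R)

lemma norm_penalizedArgmax_le (S : StrongDual ℝ V) : ‖penalizedArgmax hV hR S‖ ≤ 1 :=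
  (hV.exists_isMaxOn_penalized hR S).choose_spec.1

lemma penalized_le_penalizedArgmax (S : StrongDual ℝ V) {x : V} (hx : ‖x‖ ≤ 1) :
    penalized R S x + lam * R / 2 * ‖x - penalizedArgmax hV hR S‖ ^ 2
      ≤ penalized R S (penalizedArgmax hV hR S) :=
  hV.penalized_add_le hR (norm_penalizedArgmax_le hV hR S)
    (hV.exists_isMaxOn_penalized hR S).choose_spec.2 hx

/-- Adding the quadratic gaps at the two maximizers gives the Lipschitz constant `1 / (lam * R)`.
Continuity is what makes the directions adapted. -/
lemma continuous_penalizedArgmax : Continuous (penalizedArgmax hV hR) := by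
  have hc : 0 < lam * R := mul_pos hV.1 hR
  refine (LipschitzWith.of_dist_le_mul (K := (1 / (lam * R)).toNNReal) fun S T => ?_).continuous
  have h1 := penalized_le_penalizedArgmax hV hR S (norm_penalizedArgmax_le hV hR T)
  have h2 := penalized_le_penalizedArgmax hV hR T (norm_penalizedArgmax_le hV hR S)
  set a := penalizedArgmax hV hR S
  set b := penalizedArgmax hV hR T
  have h3 : (S - T) (a - b) ≤ ‖S - T‖ * ‖a - b‖ :=
    (le_abs_self _).trans ((S - T).le_opNorm _)
  simp only [penalized] at h1 h2
  simp only [sub_apply, map_sub] at h3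
  rw [norm_sub_rev b a] at h1
  rw [Real.coe_toNNReal _ (by positivity), dist_eq_norm, dist_eq_norm, div_mul_eq_mul_div, one_mul,
    le_div_iff₀ hc]
  rcases (norm_nonneg (a - b)).eq_or_lt with h0 | h0
  · rw [← h0]; simp
  · refine le_of_mul_le_mul_right ?_ h0
    linarith

/-- The largest value of `penalized R S` on the unit ball. -/
noncomputable def penalizedMax (S : StrongDual ℝ V) : ℝ :=
  penalized R S (penalizedArgmax hV hR S)

/-- Moving the maximizer from `a` to `b` gains at most `‖g‖ * ‖b - a‖` and costs the quadratic gap;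
Young's inequality balances the two. -/
lemma penalizedMax_add_le (S g : StrongDual ℝ V) :
    penalizedMax hV hR (S + g)
      ≤ penalizedMax hV hR S + g (penalizedArgmax hV hR S) + ‖g‖ ^ 2 / (2 * lam * R) := by
  have hc : 0 < lam * R := mul_pos hV.1 hR
  have h1 := penalized_le_penalizedArgmax hV hR S (norm_penalizedArgmax_le hV hR (S + g))
  simp only [penalizedMax]
  set a := penalizedArgmax hV hR S
  set b := penalizedArgmax hV hR (S + g)
  have h3 : g (b - a) ≤ ‖g‖ * ‖b - a‖ := (le_abs_self _).trans (g.le_opNorm _)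
  have h4 : ‖g‖ * ‖b - a‖ ≤ lam * R / 2 * ‖b - a‖ ^ 2 + ‖g‖ ^ 2 / (2 * lam * R) := by
    have : lam * R / 2 * ‖b - a‖ ^ 2 + ‖g‖ ^ 2 / (2 * lam * R) - ‖g‖ * ‖b - a‖
        = (lam * R * ‖b - a‖ - ‖g‖) ^ 2 / (2 * (lam * R)) := by
      have := hV.1.ne'
      have := hR.ne'
      field_simp
      ring
    have h5 : 0 ≤ (lam * R * ‖b - a‖ - ‖g‖) ^ 2 / (2 * (lam * R)) := by positivity
    linarith
  simp only [penalized, add_apply] at h1 ⊢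
  rw [map_sub] at h3
  linarith

lemma norm_le_penalizedMax_add (S : StrongDual ℝ V) : ‖S‖ ≤ penalizedMax hV hR S + R / 2 := by
  have hc : 0 < lam * R := mul_pos hV.1 hR
  have hball : ∀ x : V, ‖x‖ ≤ 1 → S x ≤ penalizedMax hV hR S + R / 2 := by
    intro x hx
    have h := penalized_le_penalizedArgmax hV hR S hx
    have h1 : ‖x‖ ^ 2 ≤ 1 := pow_le_one₀ (norm_nonneg _) hx
    have h2 : 0 ≤ lam * R / 2 * ‖x - penalizedArgmax hV hR S‖ ^ 2 := by positivity
    have h3 : R / 2 * ‖x‖ ^ 2 ≤ R / 2 * 1 := by gcongr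
    simp only [penalizedMax]
    rw [penalized] at h
    linarith
  have h0 : 0 ≤ penalizedMax hV hR S + R / 2 := by simpa using hball 0 (by simp)
  refine ContinuousLinearMap.opNorm_le_of_unit_norm h0 fun x hx => ?_
  rw [Real.norm_eq_abs, abs_le']
  refine ⟨hball x hx.le, ?_⟩
  simpa using hball (-x) (by simp [hx])

/-- Regret bound for the predictable choice `penalizedArgmax` of directions. -/
lemma norm_sum_le_of_penalizedArgmax (g : ℕ → StrongDual ℝ V) (t : ℕ) :
    ‖∑ s ∈ Finset.Icc 1 t, g s‖ ≤ R / 2 + (∑ s ∈ Finset.Icc 1 t, ‖g s‖ ^ 2) / (2 * lam * R)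
      + ∑ s ∈ Finset.range t, g (s + 1) (penalizedArgmax hV hR (∑ i ∈ Finset.Icc 1 s, g i)) := by
  have key : penalizedMax hV hR (∑ s ∈ Finset.Icc 1 t, g s)
      ≤ (∑ s ∈ Finset.Icc 1 t, ‖g s‖ ^ 2) / (2 * lam * R)
      + ∑ s ∈ Finset.range t, g (s + 1) (penalizedArgmax hV hR (∑ i ∈ Finset.Icc 1 s, g i)) := by
    induction t with
    | zero => simp [penalizedMax, penalized]; positivity
    | succ t ih =>
      have h := penalizedMax_add_le hV hR (∑ s ∈ Finset.Icc 1 t, g s) (g (t + 1))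
      rw [Finset.sum_Icc_succ_top (by omega), Finset.sum_Icc_succ_top (by omega),
        Finset.sum_range_succ, add_div]
      linarith
  linarith [norm_le_penalizedMax_add hV hR (∑ s ∈ Finset.Icc 1 t, g s)]

end Regularized

/-! ### Ville's inequality and exponential supermartingales in predictable directions. -/

section Supermartingale

open scoped ENNReal

variable {Ω : Type*} {mΩ : MeasurableSpace Ω} {P : Measure Ω} {ℱ : Filtration ℕ mΩ}

/-- Ville's maximal inequality for a nonnegative supermartingale, the supermartingale property
being stated by integrals over sets of the filtration. -/
lemma mul_measure_exists_le_lintegral {M : ℕ → Ω → ℝ≥0∞} (hM : ∀ n, Measurable[ℱ n] (M n))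
    (hstep : ∀ n A, MeasurableSet[ℱ n] A → ∫⁻ ω in A, M (n + 1) ω ∂P ≤ ∫⁻ ω in A, M n ω ∂P)
    (c : ℝ≥0∞) : c * P {ω | ∃ n, c ≤ M n ω} ≤ ∫⁻ ω, M 0 ω ∂P := by
  have hlev : ∀ n, MeasurableSet[ℱ n] {ω | c ≤ M n ω} := fun n => by
    have h : MeasurableSet[ℱ n] (M n ⁻¹' Set.Ici c) := hM n measurableSet_Ici
    exact h
  set B : ℕ → Set Ω := fun n => {ω | ∃ s < n, c ≤ M s ω} with hB
  have hBsucc : ∀ n, B (n + 1) = B n ∪ {ω | c ≤ M n ω} := by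
    intro n
    ext ω
    simp only [hB, Set.mem_ofPred_eq, Set.mem_union, Nat.lt_succ_iff_lt_or_eq]
    constructor
    · rintro ⟨s, h | rfl, hs⟩
      · exact Or.inl ⟨s, h, hs⟩
      · exact Or.inr hs
    · rintro (⟨s, h, hs⟩ | hs)
      · exact ⟨s, Or.inl h, hs⟩
      · exact ⟨n, Or.inr rfl, hs⟩
  have hBmeas : ∀ n, MeasurableSet[ℱ n] (B n) := by
    intro n
    induction n with
    | zero => simp [hB]
    | succ n ih =>
      rw [hBsucc]
      exact ℱ.mono n.le_succ _ (ih.union (hlev n))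
  -- `B n` is the event of a crossing strictly before `n`. The left side bounds below the
  -- expectation of the process stopped at its first crossing, and it never exceeds the initial
  -- expectation.
  have key : ∀ n, ∫⁻ ω in (B n)ᶜ, M n ω ∂P + c * P (B n) ≤ ∫⁻ ω, M 0 ω ∂P := by
    intro n
    induction n with
    | zero => simp [hB]
    | succ n ih =>
      refine le_trans ?_ ih
      have hsplit : (B n)ᶜ = (B (n + 1))ᶜ ∪ ((B n)ᶜ ∩ {ω | c ≤ M n ω}) := by
        rw [hBsucc]
        ext ω
        simp only [Set.mem_union, Set.mem_compl_iff, Set.mem_inter_iff]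
        tauto
      have hdisj : Disjoint (B (n + 1))ᶜ ((B n)ᶜ ∩ {ω | c ≤ M n ω}) := by
        rw [hBsucc, Set.disjoint_left]
        intro ω h1 h2
        exact h1 (Or.inr h2.2)
      have hmeas : MeasurableSet[ℱ n] ((B n)ᶜ ∩ {ω | c ≤ M n ω}) :=
        (hBmeas n).compl.inter (hlev n)
      have hBn1 : MeasurableSet[ℱ n] (B (n + 1)) := by
        rw [hBsucc]; exact (hBmeas n).union (hlev n)
      have h1 : ∫⁻ ω in (B n)ᶜ, M n ω ∂P = ∫⁻ ω in (B (n + 1))ᶜ, M n ω ∂P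
          + ∫⁻ ω in (B n)ᶜ ∩ {ω | c ≤ M n ω}, M n ω ∂P := by
        conv_lhs => rw [hsplit]
        exact lintegral_union (ℱ.le n _ hmeas) hdisj
      have h2 : c * P ((B n)ᶜ ∩ {ω | c ≤ M n ω})
          ≤ ∫⁻ ω in (B n)ᶜ ∩ {ω | c ≤ M n ω}, M n ω ∂P := by
        rw [← setLIntegral_const]
        exact setLIntegral_mono' (ℱ.le n _ hmeas) fun ω hω => hω.2
      have h3 : P (B (n + 1)) ≤ P (B n) + P ((B n)ᶜ ∩ {ω | c ≤ M n ω}) := by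
        refine (measure_mono ?_).trans (measure_union_le _ _)
        rw [hBsucc]
        intro ω
        simp only [Set.mem_union, Set.mem_compl_iff, Set.mem_inter_iff]
        tauto
      calc ∫⁻ ω in (B (n + 1))ᶜ, M (n + 1) ω ∂P + c * P (B (n + 1))
          ≤ ∫⁻ ω in (B (n + 1))ᶜ, M n ω ∂P
            + c * (P (B n) + P ((B n)ᶜ ∩ {ω | c ≤ M n ω})) := by
            exact add_le_add (hstep n _ hBn1.compl) (mul_le_mul_right h3 c)
        _ ≤ ∫⁻ ω in (B n)ᶜ, M n ω ∂P + c * P (B n) := by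
            rw [h1, mul_add, add_assoc, add_comm (c * P (B n))]
            gcongr
  have hUnion : {ω | ∃ n, c ≤ M n ω} = ⋃ n, B n := by
    ext ω
    simp only [hB, Set.mem_ofPred_eq, Set.mem_iUnion]
    exact ⟨fun ⟨n, h⟩ => ⟨n + 1, n, n.lt_succ_self, h⟩, fun ⟨_, s, _, h⟩ => ⟨s, h⟩⟩
  have hmono : Monotone B := fun m n hmn ω ⟨s, hs, h⟩ => ⟨s, hs.trans_le hmn, h⟩
  rw [hUnion, hmono.measure_iUnion, ENNReal.mul_iSup]
  exact iSup_le fun n => le_add_self.trans (key n)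

variable {V : Type*} [NormedAddCommGroup V] [NormedSpace ℝ V]
  {g : ℕ → Ω → StrongDual ℝ V} {σ : ℝ}

lemma IsCondSubgaussianDual.setLIntegral_exp_const_le [IsProbabilityMeasure P]
    (hsub : IsCondSubgaussianDual P ℱ g σ) (t : ℕ) {v : V} (hv : ‖v‖ ≤ 1) (β : ℝ) {A : Set Ω}
    (hA : MeasurableSet[ℱ t] A) :
    ∫⁻ ω in A, ENNReal.ofReal (Real.exp (β * g (t + 1) ω v)) ∂P
      ≤ ENNReal.ofReal (Real.exp (β ^ 2 * σ ^ 2 / 2)) * P A := by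
  obtain ⟨hint, hle⟩ := hsub t v hv β
  rw [← ofReal_integral_eq_lintegral_ofReal hint.integrableOn
    (Filter.Eventually.of_forall fun ω => (Real.exp_pos _).le),
    ← setIntegral_condExp (ℱ.le t) hint hA]
  have h : ∫ ω in A, (P[fun ω' => Real.exp (β * g (t + 1) ω' v) | ℱ t]) ω ∂P
      ≤ ∫ _ in A, Real.exp (β ^ 2 * σ ^ 2 / 2) ∂P :=
    setIntegral_mono_ae integrable_condExp.integrableOn (integrable_const _).integrableOn hle
  refine (ENNReal.ofReal_le_ofReal h).trans ?_
  rw [setIntegral_const, smul_eq_mul, mul_comm, ENNReal.ofReal_mul (Real.exp_pos _).le,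
    measureReal_def, ENNReal.ofReal_toReal (measure_ne_top P A)]

/-- The hypothesis concerns deterministic directions. A simple direction is constant on each of its
finitely many `ℱ t`-measurable fibres; the general case follows by approximation within the unit
ball and Fatou. -/
lemma IsCondSubgaussianDual.setLIntegral_exp_le [IsProbabilityMeasure P]
    (hg : ∀ t, StronglyMeasurable[ℱ (t + 1)] (g (t + 1)))
    (hsub : IsCondSubgaussianDual P ℱ g σ) (t : ℕ) {a : Ω → V} (ha : StronglyMeasurable[ℱ t] a)
    (ha1 : ∀ ω, ‖a ω‖ ≤ 1) (β : ℝ) {A : Set Ω} (hA : MeasurableSet[ℱ t] A) :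
    ∫⁻ ω in A, ENNReal.ofReal (Real.exp (β * g (t + 1) ω (a ω))) ∂P
      ≤ ENNReal.ofReal (Real.exp (β ^ 2 * σ ^ 2 / 2)) * P A := by
  have hsimple : ∀ φ : @SimpleFunc Ω (ℱ t) V, (∀ ω, ‖φ ω‖ ≤ 1) →
      ∫⁻ ω in A, ENNReal.ofReal (Real.exp (β * g (t + 1) ω (φ ω))) ∂P
        ≤ ENNReal.ofReal (Real.exp (β ^ 2 * σ ^ 2 / 2)) * P A := by
    intro φ hφ
    have hmeas : ∀ v, MeasurableSet[ℱ t] (A ∩ φ ⁻¹' {v}) := fun v =>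
      hA.inter (@SimpleFunc.measurableSet_fiber Ω V (ℱ t) φ v)
    set r : Finset V := @SimpleFunc.range Ω V (ℱ t) φ with hr
    have hU : A = ⋃ v ∈ r, A ∩ φ ⁻¹' {v} := by
      ext ω
      have : φ ω ∈ r := @SimpleFunc.mem_range_self Ω V (ℱ t) φ ω
      simp [this]
    have hd : Set.PairwiseDisjoint (r : Set V) fun v => A ∩ φ ⁻¹' {v} := by
      intro v _ w _ hvw
      refine Set.disjoint_left.2 fun ω h1 h2 => hvw ?_
      exact (Set.mem_singleton_iff.1 h1.2).symm.trans (Set.mem_singleton_iff.1 h2.2)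
    have hP : P A = ∑ v ∈ r, P (A ∩ φ ⁻¹' {v}) := by
      conv_lhs => rw [hU]
      exact measure_biUnion_finset hd fun v _ => ℱ.le t _ (hmeas v)
    have hI := lintegral_biUnion_finset (μ := P) hd (fun v _ => ℱ.le t _ (hmeas v))
      (fun ω => ENNReal.ofReal (Real.exp (β * g (t + 1) ω (φ ω))))
    rw [← hU] at hI
    rw [hI, hP, Finset.mul_sum]
    refine Finset.sum_le_sum fun v hv => ?_
    obtain ⟨ω₀, rfl⟩ := (@SimpleFunc.mem_range Ω V (ℱ t) φ v).1 hv
    refine le_trans (le_of_eq ?_) (hsub.setLIntegral_exp_const_le t (hφ ω₀) β (hmeas _))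
    refine setLIntegral_congr_fun (ℱ.le t _ (hmeas _)) fun ω hω => ?_
    rw [Set.mem_singleton_iff.1 hω.2]
  set φ := fun n => ha.approxBounded 1 n
  have hlim : ∀ ω, Filter.Tendsto
      (fun n => ENNReal.ofReal (Real.exp (β * g (t + 1) ω (φ n ω)))) Filter.atTop
      (nhds (ENNReal.ofReal (Real.exp (β * g (t + 1) ω (a ω))))) := fun ω => by
    have h := ha.tendsto_approxBounded_of_norm_le (ha1 ω)
    have hc : Continuous fun x : V => ENNReal.ofReal (Real.exp (β * g (t + 1) ω x)) :=
      ENNReal.continuous_ofReal.comp (by fun_prop)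
    exact (hc.tendsto _).comp h
  have hpair : ∀ n, Measurable fun ω => ENNReal.ofReal (Real.exp (β * g (t + 1) ω (φ n ω))) := by
    intro n
    have h1 : StronglyMeasurable (g (t + 1)) := (hg t).mono (ℱ.le _)
    have h2 : StronglyMeasurable (φ n) :=
      (@SimpleFunc.stronglyMeasurable Ω V (ℱ t) _ (φ n)).mono (ℱ.le _)
    have h3 : StronglyMeasurable fun ω => g (t + 1) ω (φ n ω) :=
      isBoundedBilinearMap_apply.continuous.comp_stronglyMeasurable (h1.prodMk h2)
    exact ((h3.measurable.const_mul β).exp).ennreal_ofReal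
  calc ∫⁻ ω in A, ENNReal.ofReal (Real.exp (β * g (t + 1) ω (a ω))) ∂P
      = ∫⁻ ω in A, Filter.liminf
          (fun n => ENNReal.ofReal (Real.exp (β * g (t + 1) ω (φ n ω)))) Filter.atTop ∂P :=
        lintegral_congr fun ω => (hlim ω).liminf_eq.symm
    _ ≤ Filter.liminf (fun n => ∫⁻ ω in A,
          ENNReal.ofReal (Real.exp (β * g (t + 1) ω (φ n ω))) ∂P) Filter.atTop :=
        lintegral_liminf_le hpair
    _ ≤ Filter.liminf (fun _ : ℕ => ENNReal.ofReal (Real.exp (β ^ 2 * σ ^ 2 / 2)) * P A)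
          Filter.atTop := by
        refine Filter.liminf_le_liminf (Filter.Eventually.of_forall fun n => ?_)
        exact hsimple (φ n) (ha.norm_approxBounded_le zero_le_one n)
    _ = _ := Filter.liminf_const _

lemma stronglyMeasurable_eval (hg : ∀ t, StronglyMeasurable[ℱ (t + 1)] (g (t + 1))) (t : ℕ)
    {a : Ω → V} (ha : StronglyMeasurable[ℱ t] a) :
    StronglyMeasurable[ℱ (t + 1)] fun ω => g (t + 1) ω (a ω) :=
  isBoundedBilinearMap_apply.continuous.comp_stronglyMeasurable
    ((hg t).prodMk (ha.mono (ℱ.mono t.le_succ)))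

lemma IsCondSubgaussianDual.lintegral_mul_exp_le [IsProbabilityMeasure P]
    (hg : ∀ t, StronglyMeasurable[ℱ (t + 1)] (g (t + 1)))
    (hsub : IsCondSubgaussianDual P ℱ g σ) (t : ℕ) {a : Ω → V} (ha : StronglyMeasurable[ℱ t] a)
    (ha1 : ∀ ω, ‖a ω‖ ≤ 1) (β : ℝ) {Z : Ω → ℝ≥0∞} (hZ : Measurable[ℱ t] Z) :
    ∫⁻ ω, Z ω * ENNReal.ofReal (Real.exp (β * g (t + 1) ω (a ω))) ∂P
      ≤ ENNReal.ofReal (Real.exp (β ^ 2 * σ ^ 2 / 2)) * ∫⁻ ω, Z ω ∂P := by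
  set f : Ω → ℝ≥0∞ := fun ω => ENNReal.ofReal (Real.exp (β * g (t + 1) ω (a ω))) with hf
  set c := ENNReal.ofReal (Real.exp (β ^ 2 * σ ^ 2 / 2))
  have hfm : Measurable f :=
    ((((stronglyMeasurable_eval hg t ha).mono (ℱ.le _)).measurable.const_mul β).exp).ennreal_ofReal
  -- The bounds over sets of `ℱ t` amount to a comparison of measures on `ℱ t`, which then
  -- integrates any `ℱ t`-measurable `Z`.
  have hle : (P.withDensity f).trim (ℱ.le t) ≤ (c • P).trim (ℱ.le t) := by
    refine Measure.le_iff.2 fun A hA => ?_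
    rw [trim_measurableSet_eq _ hA, trim_measurableSet_eq _ hA,
      withDensity_apply _ (ℱ.le t _ hA), Measure.smul_apply, smul_eq_mul]
    exact hsub.setLIntegral_exp_le hg t ha ha1 β hA
  have hZ' : Measurable Z := hZ.mono (ℱ.le t) le_rfl
  calc ∫⁻ ω, Z ω * f ω ∂P = ∫⁻ ω, Z ω ∂(P.withDensity f) := by
        rw [lintegral_withDensity_eq_lintegral_mul _ hfm hZ']
        simp only [Pi.mul_apply, mul_comm]
    _ = ∫⁻ ω, Z ω ∂((P.withDensity f).trim (ℱ.le t)) := (lintegral_trim _ hZ).symm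
    _ ≤ ∫⁻ ω, Z ω ∂((c • P).trim (ℱ.le t)) := lintegral_mono' hle le_rfl
    _ = ∫⁻ ω, Z ω ∂(c • P) := lintegral_trim _ hZ
    _ = c * ∫⁻ ω, Z ω ∂P := by rw [lintegral_smul_measure, smul_eq_mul]

/-- Time-uniform line-crossing inequality for sums of a conditionally sub-Gaussian sequence
evaluated in predictable directions of the unit ball. -/
lemma IsCondSubgaussianDual.measure_exists_le [IsProbabilityMeasure P]
    (hg : ∀ t, StronglyMeasurable[ℱ (t + 1)] (g (t + 1)))
    (hsub : IsCondSubgaussianDual P ℱ g σ) {a : ℕ → Ω → V}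
    (ha : ∀ t, StronglyMeasurable[ℱ t] (a t)) (ha1 : ∀ t ω, ‖a t ω‖ ≤ 1) (β x : ℝ) :
    P {ω | ∃ t : ℕ, x ≤ β * ∑ s ∈ Finset.range t, g (s + 1) ω (a s ω) - t * (β ^ 2 * σ ^ 2 / 2)}
      ≤ ENNReal.ofReal (Real.exp (-x)) := by
  set L : ℕ → Ω → ℝ := fun t ω =>
    β * ∑ s ∈ Finset.range t, g (s + 1) ω (a s ω) - t * (β ^ 2 * σ ^ 2 / 2) with hL
  set M : ℕ → Ω → ℝ≥0∞ := fun t ω => ENNReal.ofReal (Real.exp (L t ω)) with hMdef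
  have hLm : ∀ t, Measurable[ℱ t] (L t) := by
    intro t
    refine ((Finset.measurable_fun_sum _ fun s hs => ?_).const_mul β).sub_const _
    exact ((stronglyMeasurable_eval hg s (ha s)).mono
      (ℱ.mono (Finset.mem_range.1 hs))).measurable
  have hM : ∀ t, Measurable[ℱ t] (M t) := fun t => (hLm t).exp.ennreal_ofReal
  have hstep : ∀ n A, MeasurableSet[ℱ n] A →
      ∫⁻ ω in A, M (n + 1) ω ∂P ≤ ∫⁻ ω in A, M n ω ∂P := by
    intro n A hA
    set K := ENNReal.ofReal (Real.exp (-(β ^ 2 * σ ^ 2 / 2)))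
    have hMs : ∀ ω, M (n + 1) ω
        = K * (M n ω * ENNReal.ofReal (Real.exp (β * g (n + 1) ω (a n ω)))) := by
      intro ω
      simp only [hMdef, hL, K]
      rw [← ENNReal.ofReal_mul (Real.exp_pos _).le, ← ENNReal.ofReal_mul (Real.exp_pos _).le,
        ← Real.exp_add, ← Real.exp_add, Finset.sum_range_succ]
      congr 2
      push_cast
      ring
    have h := hsub.lintegral_mul_exp_le hg n (ha n) (ha1 n) β ((hM n).indicator hA)
    have hK : K * ENNReal.ofReal (Real.exp (β ^ 2 * σ ^ 2 / 2)) = 1 := by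
      rw [← ENNReal.ofReal_mul (Real.exp_pos _).le, ← Real.exp_add, neg_add_cancel, Real.exp_zero,
        ENNReal.ofReal_one]
    have hA' := ℱ.le n _ hA
    calc ∫⁻ ω in A, M (n + 1) ω ∂P
        = K * ∫⁻ ω, A.indicator (M n) ω
            * ENNReal.ofReal (Real.exp (β * g (n + 1) ω (a n ω))) ∂P := by
          simp only [hMs]
          rw [lintegral_const_mul' _ _ ENNReal.ofReal_ne_top, ← lintegral_indicator hA']
          congr 1
          refine lintegral_congr fun ω => ?_
          by_cases hω : ω ∈ A <;> simp [hω]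
      _ ≤ K * (ENNReal.ofReal (Real.exp (β ^ 2 * σ ^ 2 / 2))
            * ∫⁻ ω, A.indicator (M n) ω ∂P) := by gcongr
      _ = ∫⁻ ω in A, M n ω ∂P := by
          rw [← mul_assoc, hK, one_mul, lintegral_indicator hA']
  have hV := mul_measure_exists_le_lintegral (P := P) hM hstep (ENNReal.ofReal (Real.exp x))
  have h0 : ∫⁻ ω, M 0 ω ∂P = 1 := by simp [hMdef, hL]
  have hset : {ω | ∃ n, ENNReal.ofReal (Real.exp x) ≤ M n ω} = {ω | ∃ t, x ≤ L t ω} := by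
    ext ω
    simp only [hMdef, Set.mem_ofPred_eq, ENNReal.ofReal_le_ofReal_iff (Real.exp_pos _).le,
      Real.exp_le_exp]
  rw [h0, hset] at hV
  rw [Real.exp_neg, ENNReal.ofReal_inv_of_pos (Real.exp_pos _)]
  rw [← one_div]
  refine (ENNReal.le_div_iff_mul_le (Or.inl ?_) (Or.inl ENNReal.ofReal_ne_top)).2 ?_
  · simp [Real.exp_pos]
  · rwa [mul_comm]

end Supermartingale

/-! ### Calibration of epochs, levels and the failure probability. -/

section Numerics

/-- Both sides decay like `j ^ (-3 / 2)`; the right one telescopes. -/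
lemma exp_neg_log_le_sub_inv_sqrt (j : ℕ) :
    Real.exp (-(3 / 4 * Real.log (1 + (j * Real.log 2) ^ 2)))
      ≤ 9 * (1 / √((j : ℝ) + 1) - 1 / √((j : ℝ) + 1 + 1)) := by
  set B : ℝ := 1 + (j * Real.log 2) ^ 2 with hB
  have hBpos : 0 < B := by positivity
  set p := √((j : ℝ) + 1) with hp
  set q := √((j : ℝ) + 1 + 1) with hq
  have hp0 : 0 < p := Real.sqrt_pos.2 (by positivity)
  have hq0 : 0 < q := Real.sqrt_pos.2 (by positivity)
  have hpq : p ≤ q := Real.sqrt_le_sqrt (by linarith)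
  have hp2 : p ^ 2 = j + 1 := Real.sq_sqrt (by positivity)
  have hq2 : q ^ 2 = j + 1 + 1 := Real.sq_sqrt (by positivity)
  have hw : 1 / (2 * q ^ 3) ≤ 1 / p - 1 / q := by
    rw [div_sub_div _ _ hp0.ne' hq0.ne', div_le_div_iff₀ (by positivity) (by positivity)]
    have h1 : (q - p) * (q + p) = 1 := by nlinarith
    have h2 : p * q * (p + q) ≤ 2 * q ^ 3 := by
      calc p * q * (p + q) ≤ q * q * (q + q) := by gcongr
        _ = 2 * q ^ 3 := by ring
    have h3 : 0 ≤ q - p := by linarith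
    have h4 : p * q = (q - p) * (p * q * (p + q)) := by linear_combination -(p * q) * h1
    nlinarith [mul_le_mul_of_nonneg_left h2 h3]
  have hE : 2 * q ^ 3 / 9 ≤ Real.exp (3 / 4 * Real.log B) := by
    refine (pow_le_pow_iff_left₀ (by positivity) (Real.exp_pos _).le (n := 4) (by norm_num)).1 ?_
    have e1 : Real.exp (3 / 4 * Real.log B) ^ 4 = B ^ 3 := by
      rw [← Real.exp_nat_mul]
      have : ((4 : ℕ) : ℝ) * (3 / 4 * Real.log B) = (3 : ℕ) * Real.log B := by push_cast; ring
      rw [this, Real.exp_nat_mul, Real.exp_log hBpos]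
    have hl : 0.6 ≤ Real.log 2 := by have := Real.log_two_gt_d9; linarith
    have h7 : q ^ 4 ≤ 7 * B := by
      have e2 : q ^ 4 = ((j : ℝ) + 1 + 1) ^ 2 := by rw [← hq2]; ring
      have h8 : ((j : ℝ) * 0.6) ^ 2 ≤ (j * Real.log 2) ^ 2 := by gcongr
      rw [e2, hB]
      nlinarith [sq_nonneg ((j : ℝ) * 1.2 - 1.7)]
    have h9 : (q ^ 4) ^ 3 ≤ (7 * B) ^ 3 := by gcongr
    rw [e1]
    nlinarith [pow_pos hBpos 3]
  rw [Real.exp_neg]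
  calc (Real.exp (3 / 4 * Real.log B))⁻¹ ≤ (2 * q ^ 3 / 9)⁻¹ := by gcongr
    _ = 9 * (1 / (2 * q ^ 3)) := by field_simp
    _ ≤ 9 * (1 / p - 1 / q) := by gcongr

lemma tsum_ofReal_mul_sub_inv_sqrt_le {δ : ℝ} (hδ : 0 ≤ δ) :
    ∑' j : ℕ, ENNReal.ofReal (δ * (1 / √((j : ℝ) + 1) - 1 / √((j : ℝ) + 1 + 1)))
      ≤ ENNReal.ofReal δ := by
  refine ENNReal.tsum_le_of_sum_range_le fun n => ?_
  have h0 : ∀ j : ℕ, 0 ≤ 1 / √((j : ℝ) + 1) - 1 / √((j : ℝ) + 1 + 1) := fun j => by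
    have h1 : √((j : ℝ) + 1) ≤ √((j : ℝ) + 1 + 1) := Real.sqrt_le_sqrt (by linarith)
    have h2 : 0 < √((j : ℝ) + 1) := Real.sqrt_pos.2 (by positivity)
    exact sub_nonneg.2 (one_div_le_one_div_of_le h2 h1)
  rw [← ENNReal.ofReal_sum_of_nonneg fun j _ => mul_nonneg hδ (h0 j), ← Finset.mul_sum]
  refine ENNReal.ofReal_le_ofReal ?_
  have h := Finset.sum_range_sub' (fun j : ℕ => 1 / √((j : ℝ) + 1)) n
  simp only [Nat.cast_add, Nat.cast_one] at h
  rw [h]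
  have h3 : 0 ≤ 1 / √((n : ℝ) + 1) := by positivity
  simp only [CharP.cast_eq_zero, zero_add, Real.sqrt_one, div_one]
  nlinarith

/-- The logarithmic factor of the boundary at times of order `4 ^ j`. -/
noncomputable def epochLog (δ : ℝ) (j : ℕ) : ℝ :=
  3 / 2 * Real.log (6 * Real.pi * √(Real.exp 1) / δ) + Real.log (1 + (j * Real.log 2) ^ 2)

lemma three_le_log_of_lt_one {δ : ℝ} (hδ : 0 < δ) (hδ1 : δ < 1) :
    3 ≤ Real.log (6 * Real.pi * √(Real.exp 1) / δ) := by
  have hpi := Real.pi_gt_three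
  have he := Real.exp_one_lt_d9
  rw [Real.le_log_iff_exp_le (by positivity), le_div_iff₀ hδ]
  have h1 : Real.exp 3 = Real.exp 1 ^ 2 * (√(Real.exp 1) * √(Real.exp 1)) := by
    rw [Real.mul_self_sqrt (Real.exp_pos _).le, ← pow_succ, ← Real.exp_nat_mul]
    norm_num
  have h2 : √(Real.exp 1) ≤ 1.7 := by
    rw [Real.sqrt_le_left (by norm_num)]; linarith
  have h3 : Real.exp 1 ^ 2 ≤ 2.72 ^ 2 := by gcongr; linarith
  have h4 : Real.exp 1 ^ 2 * √(Real.exp 1) ≤ 2.72 ^ 2 * 1.7 := by gcongr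
  have h5 : 0 < √(Real.exp 1) := by positivity
  calc Real.exp 3 * δ ≤ Real.exp 3 * 1 := by gcongr
    _ = (Real.exp 1 ^ 2 * √(Real.exp 1)) * √(Real.exp 1) := by rw [h1]; ring
    _ ≤ (6 * Real.pi) * √(Real.exp 1) := by exact mul_le_mul_of_nonneg_right (by linarith) h5.le

lemma three_le_sqrt_epochLog {δ : ℝ} (hδ : 0 < δ) (hδ1 : δ < 1) (j : ℕ) :
    3 ≤ √(2 * epochLog δ j) := by
  have h1 := three_le_log_of_lt_one hδ hδ1
  have h2 : 0 ≤ Real.log (1 + (j * Real.log 2) ^ 2) :=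
    Real.log_nonneg (by nlinarith [sq_nonneg ((j : ℝ) * Real.log 2)])
  apply Real.le_sqrt_of_sq_le
  rw [epochLog]
  linarith

/-- Exponent of the probability that the boundary is crossed at times of order `4 ^ j`. -/
noncomputable def epochExponent (δ : ℝ) (j : ℕ) : ℝ :=
  4 / 9 * √(2 * epochLog δ j) ^ 2 - √(2 * epochLog δ j) / 3

lemma exp_neg_epochExponent_le {δ : ℝ} (hδ : 0 < δ) (hδ1 : δ < 1) (j : ℕ) :
    Real.exp (-epochExponent δ j) * 2
      ≤ δ * (1 / √((j : ℝ) + 1) - 1 / √((j : ℝ) + 1 + 1)) := by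
  have h1 := three_le_log_of_lt_one hδ hδ1
  have h2 : 0 ≤ Real.log (1 + (j * Real.log 2) ^ 2) :=
    Real.log_nonneg (by nlinarith [sq_nonneg ((j : ℝ) * Real.log 2)])
  have hw := exp_neg_log_le_sub_inv_sqrt j
  set x := Real.log (6 * Real.pi * √(Real.exp 1) / δ) with hx
  set l := Real.log (1 + (j * Real.log 2) ^ 2) with hl
  set w := 1 / √((j : ℝ) + 1) - 1 / √((j : ℝ) + 1 + 1)
  have hpi := Real.pi_gt_three
  have hepos : 0 < √(Real.exp 1) := by positivity
  have hD2 : √(2 * epochLog δ j) ^ 2 = 2 * (3 / 2 * x + l) := by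
    rw [Real.sq_sqrt, epochLog]
    rw [epochLog]; linarith
  -- With `D = √(2 * epochLog δ j)`, the square gives `D / 3 ≤ D ^ 2 / 18 + 1 / 2`, and `7 / 18 * D
  -- ^ 2 = 7 / 6 * x + 7 / 9 * l`. The lost `1 / 2` is the source of `√e` in the boundary.
  have hy : x + 3 / 4 * l - 1 / 2 ≤ epochExponent δ j := by
    rw [epochExponent]
    nlinarith [sq_nonneg (√(2 * epochLog δ j) - 3)]
  have hex : Real.exp (-x) = δ / (6 * Real.pi * √(Real.exp 1)) := by
    rw [Real.exp_neg, hx, Real.exp_log (by positivity), inv_div]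
  have hw0 : 0 ≤ w := by have := Real.exp_pos (-(3 / 4 * l)); linarith
  calc Real.exp (-epochExponent δ j) * 2
      ≤ Real.exp (-(x + 3 / 4 * l - 1 / 2)) * 2 := by gcongr
    _ = Real.exp (-x) * Real.exp (-(3 / 4 * l)) * Real.exp (1 / 2) * 2 := by
        rw [← Real.exp_add, ← Real.exp_add]; ring_nf
    _ = δ * (Real.exp (-(3 / 4 * l)) / (3 * Real.pi)) := by
        rw [hex, Real.exp_half]; field_simp; norm_num
    -- The factor 9 from `hw` is absorbed because `9 ≤ 3 * π`.
    _ ≤ δ * w := by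
        gcongr
        rw [div_le_iff₀ (by positivity)]
        nlinarith

/-- Choice of the regularization level `σ * u * 2 ^ k` for a given quadratic variation `v ^ 2` at a
time `t` in `[u ^ 2, 4 * u ^ 2]`. -/
lemma exists_level {σ u D v t : ℝ} (hσ : 0 < σ) (hu : 0 < u) (hD : 3 ≤ D) (hv : 0 ≤ v)
    (ht1 : u ^ 2 ≤ t) (ht2 : t ≤ 4 * u ^ 2) :
    ∃ k : ℕ, ∀ N : ℝ,
      √2 * v + σ * (D * √t) ≤ σ * u * 2 ^ k / 2 + v ^ 2 / (2 * (σ * u * 2 ^ k)) + N →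
      4 / 9 * D ^ 2 - D / 3 + k * Real.log 2
        ≤ 2 * D / (3 * σ * u) * N - t * ((2 * D / (3 * σ * u)) ^ 2 * σ ^ 2 / 2) := by
  have hs2 : 1.41 ≤ √2 := Real.le_sqrt_of_sq_le (by norm_num)
  have ht0 : 0 ≤ t := (sq_nonneg u).trans ht1
  -- This is the chord of the square root between `u ^ 2` and `4 * u ^ 2`. The slope `2 * D / (3 * σ
  -- * u)` makes its linear term cancel the compensator in `hmain`, leaving `4 / 9 * D ^ 2`.
  have hchord : (t + 2 * u ^ 2) / (3 * u) ≤ √t := by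
    rw [div_le_iff₀ (by positivity)]
    have h1 : u ≤ √t := Real.le_sqrt_of_sq_le ht1
    have h2 : √t ≤ 2 * u := by
      rw [Real.sqrt_le_left (by positivity)]; linarith
    nlinarith [Real.sq_sqrt ht0]
  have hmain : ∀ F N : ℝ, σ * (D * √t) + F ≤ N → 4 / 9 * D ^ 2 + 2 * D / (3 * σ * u) * F
      ≤ 2 * D / (3 * σ * u) * N - t * ((2 * D / (3 * σ * u)) ^ 2 * σ ^ 2 / 2) := by
    intro F N h
    have h1 : σ * (D * ((t + 2 * u ^ 2) / (3 * u))) + F ≤ N := by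
      refine le_trans ?_ h
      gcongr
    have h2 := mul_le_mul_of_nonneg_left h1 (by positivity : 0 ≤ 2 * D / (3 * σ * u))
    have h3 : 2 * D / (3 * σ * u) * (σ * (D * ((t + 2 * u ^ 2) / (3 * u))) + F)
        = 4 / 9 * D ^ 2 + 2 * D / (3 * σ * u) * F
          + t * ((2 * D / (3 * σ * u)) ^ 2 * σ ^ 2 / 2) := by
      field_simp
      ring
    linarith
  have hl2 : Real.log 2 ≤ 0.7 := by have := Real.log_two_lt_d9; linarith
  rcases lt_or_ge v (σ * u) with hvu | hvu
  -- At small variation the lowest level is used; its unpaid penalty `σ * u / 2` produces the `-D /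
  -- 3` in the exponent.
  · refine ⟨0, fun N h => ?_⟩
    simp only [pow_zero, mul_one, CharP.cast_eq_zero, zero_mul, add_zero] at h ⊢
    have h1 : v ^ 2 / (2 * (σ * u)) ≤ √2 * v := by
      rw [div_le_iff₀ (by positivity)]
      have : v * v ≤ v * (σ * u) := by gcongr
      have : 1.41 * (v * (σ * u)) ≤ √2 * (v * (σ * u)) := by gcongr
      nlinarith [mul_nonneg hv (mul_pos hσ hu).le]
    have h2 := hmain (-(σ * u / 2)) N (by linarith)
    have h3 : 2 * D / (3 * σ * u) * (-(σ * u / 2)) = -(D / 3) := by field_simp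
    linarith
  · have hσu : 0 < σ * u := by positivity
    obtain ⟨k, hk1, hk2⟩ := exists_nat_pow_near ((one_le_div hσu).2 hvu) (one_lt_two (α := ℝ))
    rw [le_div_iff₀ hσu] at hk1
    rw [div_lt_iff₀ hσu, pow_succ] at hk2
    refine ⟨k, fun N h => ?_⟩
    have h2k : 2 * (k : ℝ) ≤ 2 ^ k := by
      rcases k with _ | m
      · simp
      · have hm : (m + 1 : ℕ) ≤ 2 ^ m := Nat.lt_two_pow_self
        have hm' : ((m + 1 : ℕ) : ℝ) ≤ 2 ^ m := by exact_mod_cast hm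
        rw [pow_succ]
        linarith
    set R := σ * u * 2 ^ k with hR
    have hR0 : 0 < R := by positivity
    have h1 : v ^ 2 / (2 * R) ≤ 3 / 2 * v - R := by
      rw [div_le_iff₀ (by positivity)]
      -- This is `(v - R) * (v - 2 * R) ≤ 0`, from `R ≤ v < 2 * R`.
      nlinarith
    have h4 : 1.41 * v ≤ √2 * v := by gcongr
    -- The slack is at least `1.41 * v - (3 / 2 * v - R / 2) = R / 2 - 0.09 * v`, and `v < 2 * R`.
    -- Being proportional to `2 ^ k`, it dominates `k * log 2`.
    have h2 := hmain (0.32 * R) N (by linarith)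
    have h3 : 2 * D / (3 * σ * u) * (0.32 * R) = 0.64 / 3 * (D * 2 ^ k) := by
      rw [hR]; field_simp
      ring
    have h5 : 3 * (2 : ℝ) ^ k ≤ D * 2 ^ k := by gcongr
    have h6 : (k : ℝ) * Real.log 2 ≤ k * 0.7 := by gcongr
    have h7 : (0 : ℝ) ≤ k := k.cast_nonneg
    linarith

lemma exists_epoch {δ : ℝ} (hδ : 0 < δ) {t : ℕ} (ht : 1 ≤ t) :
    ∃ j : ℕ, ((2 : ℝ) ^ j) ^ 2 ≤ t ∧ (t : ℝ) ≤ 4 * ((2 : ℝ) ^ j) ^ 2 ∧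
      √(2 * epochLog δ j) * √t ≤ √(2 * (t : ℝ) *
        Real.log ((6 * Real.pi * √(Real.exp 1) / δ) ^ (3 / 2 : ℝ) * (Real.log √t ^ 2 + 1))) := by
  have ht' : (1 : ℝ) ≤ t := by exact_mod_cast ht
  obtain ⟨j, hj1, hj2⟩ := exists_nat_pow_near ht' (by norm_num : (1 : ℝ) < 4)
  have h4 : (4 : ℝ) ^ j = ((2 : ℝ) ^ j) ^ 2 := by rw [← pow_mul, mul_comm, pow_mul]; norm_num
  have hpi := Real.pi_pos
  refine ⟨j, h4 ▸ hj1, ?_, ?_⟩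
  · rw [← h4]; rw [pow_succ] at hj2; linarith
  · have hlog : j * Real.log 2 ≤ Real.log √t := by
      rw [← Real.log_pow]
      refine Real.log_le_log (by positivity) (Real.le_sqrt_of_sq_le (h4 ▸ hj1))
    have h0 : 0 ≤ j * Real.log 2 := mul_nonneg j.cast_nonneg (Real.log_nonneg one_le_two)
    rw [← Real.sqrt_mul' _ (by positivity)]
    refine Real.sqrt_le_sqrt ?_
    rw [Real.log_mul (by positivity) (by positivity), Real.log_rpow (by positivity), epochLog,
      add_comm (Real.log √t ^ 2)]
    have h1 : Real.log (1 + (j * Real.log 2) ^ 2) ≤ Real.log (1 + Real.log √t ^ 2) :=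
      Real.log_le_log (by positivity) (by gcongr)
    nlinarith

end Numerics

/-! ### The union bound over epochs and levels. -/

theorem mainTheorem11 {V : Type*} [NormedAddCommGroup V] [NormedSpace ℝ V] [CompleteSpace V]
    {lam : ℝ} (hV : IsTwoUniformlyConvex V lam)
    {Ω : Type*} {mΩ : MeasurableSpace Ω} (P : Measure Ω) [IsProbabilityMeasure P]
    (ℱ : Filtration ℕ mΩ) (g : ℕ → Ω → StrongDual ℝ V)
    (hg : IsDualMartingaleDifference P ℱ g)
    (σ : ℝ) (hσ : 0 < σ) (hsub : IsCondSubgaussianDual P ℱ g σ)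
    (δ : ℝ) (hδ : 0 < δ) (hδ1 : δ < 1) :
    P {ω | ∃ t : ℕ, 1 ≤ t ∧
        Real.sqrt (2 / lam * ∑ s ∈ Finset.Icc 1 t, ‖g s ω‖ ^ 2)
          + σ * Real.sqrt (2 * (t : ℝ) *
              Real.log ((6 * Real.pi * Real.sqrt (Real.exp 1) / δ) ^ (3 / 2 : ℝ)
                * (Real.log (Real.sqrt (t : ℝ)) ^ 2 + 1)))
        ≤ ‖∑ s ∈ Finset.Icc 1 t, g s ω‖}
      ≤ ENNReal.ofReal δ := by
  have hlam := hV.1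
  have hR : ∀ j k : ℕ, 0 < σ * 2 ^ j * 2 ^ k := fun j k => by positivity
  set a : ℕ → ℕ → ℕ → Ω → V := fun j k s ω =>
    penalizedArgmax hV (hR j k) (∑ i ∈ Finset.Icc 1 s, g i ω)
  have ha : ∀ j k s, StronglyMeasurable[ℱ s] (a j k s) := by
    intro j k s
    refine (continuous_penalizedArgmax hV (hR j k)).comp_stronglyMeasurable
      (Finset.stronglyMeasurable_fun_sum _ fun i hi => ?_)
    obtain ⟨h1, h2⟩ := Finset.mem_Icc.1 hi
    obtain ⟨i, rfl⟩ := Nat.exists_eq_add_of_le' h1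
    exact (hg.adapted i).mono (ℱ.mono h2)
  set β : ℕ → ℝ := fun j => 2 * √(2 * epochLog δ j) / (3 * σ * 2 ^ j)
  -- The extra `k * log 2` gives level `k` the weight `(1 / 2) ^ k`, summing to 2. The time `t` is
  -- not confined to epoch `j`, so the line-crossing bound applies directly.
  set E : ℕ → ℕ → Set Ω := fun j k => {ω | ∃ t : ℕ, epochExponent δ j + k * Real.log 2
    ≤ β j * ∑ s ∈ Finset.range t, g (s + 1) ω (a j k s ω) - t * (β j ^ 2 * σ ^ 2 / 2)}
  have hE : ∀ j k, P (E j k)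
      ≤ ENNReal.ofReal (Real.exp (-epochExponent δ j) * (1 / 2) ^ k) := by
    intro j k
    refine (hsub.measure_exists_le hg.adapted (ha j k)
      (fun s ω => norm_penalizedArgmax_le hV (hR j k) _) (β j) _).trans (le_of_eq ?_)
    rw [neg_add, Real.exp_add, ← mul_neg, Real.exp_nat_mul, Real.exp_neg (Real.log 2),
      Real.exp_log two_pos, one_div]
  refine (measure_mono (t := ⋃ j, ⋃ k, E j k) ?_).trans ?_
  · rintro ω ⟨t, ht, h⟩
    obtain ⟨j, hj1, hj2, hj3⟩ := exists_epoch hδ ht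
    set Q := ∑ s ∈ Finset.Icc 1 t, ‖g s ω‖ ^ 2
    have hQ : 0 ≤ Q / lam := div_nonneg (Finset.sum_nonneg fun _ _ => by positivity) hlam.le
    -- The level is fixed before `N`, since the directions defining `N` depend on `k`.
    obtain ⟨k, hk⟩ := exists_level hσ (by positivity : (0 : ℝ) < 2 ^ j)
      (three_le_sqrt_epochLog hδ hδ1 j) (Real.sqrt_nonneg (Q / lam)) hj1 hj2
    refine Set.mem_iUnion₂.2 ⟨j, k, t, hk _ ?_⟩
    have hreg := norm_sum_le_of_penalizedArgmax hV (hR j k) (fun s => g s ω) t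
    have e1 : √(2 / lam * Q) = √2 * √(Q / lam) := by
      rw [← Real.sqrt_mul two_pos.le]; congr 1; ring
    have e2 : √(Q / lam) ^ 2 / (2 * (σ * 2 ^ j * 2 ^ k)) = Q / (2 * lam * (σ * 2 ^ j * 2 ^ k)) := by
      rw [Real.sq_sqrt hQ, div_div]; ring
    rw [e1] at h
    rw [e2]
    have := mul_le_mul_of_nonneg_left hj3 hσ.le
    linarith
  · calc P (⋃ j, ⋃ k, E j k) ≤ ∑' j, ∑' k, P (E j k) :=
          (measure_iUnion_le _).trans (ENNReal.tsum_le_tsum fun j => measure_iUnion_le _)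
      _ ≤ ∑' j : ℕ, ENNReal.ofReal
            (δ * (1 / √((j : ℝ) + 1) - 1 / √((j : ℝ) + 1 + 1))) := by
          refine ENNReal.tsum_le_tsum fun j => ?_
          refine (ENNReal.tsum_le_tsum (hE j)).trans ?_
          rw [← ENNReal.ofReal_tsum_of_nonneg (fun k => by positivity)
            (summable_geometric_two.mul_left _), tsum_mul_left, tsum_geometric_two]
          exact ENNReal.ofReal_le_ofReal (exp_neg_epochExponent_le hδ hδ1 j)
      _ ≤ ENNReal.ofReal δ := tsum_ofReal_mul_sub_inv_sqrt_le hδ.le
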